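/- Let $K, N, n$ be natural numbers with $N \ge 8$, $n \ge K$, $n \ge N$, and let $L = NK$. (Ranking.) In the online ranking problem with $L$ items and $K$ slots, in each round $t = 1, \dots, n$ the learner chooses a permutation $A_t$ of $[L]$ (item $A_t(k)$ is placed at position $k$), possibly at random, as a function of the past rankings and clicks, and then observes clicks $C_{t1}, \dots, C_{tL} \in \{0,1\}$, whose joint law given the past depends only on $A_t$; let $v(a,k) = \mathbb{P}(C_{t a(k)} = 1 \mid A_t = a)$. Let $\alpha : [L] \to [0,1]$ be the attractiveness function, and call a permutation $a^*$ optimal if $\alpha(a^*(k)) = \max_{k' \ge k} \alpha(a^*(k'))$ for all $k \le K$. A ranking problem is one in which (1) $v(a,k) = 0$ for $k > K$; (2) every optimal $a^*$ maximises $\sum_{k=1}^K v(a,k)$; (3) if $\alpha(i) \ge \alpha(j)$ and $\sigma$ exchanges $i$ and $j$, then $\alpha(j)\, v(a, a^{-1}(i)) \ge \alpha(i)\, v(\sigma \circ a, a^{-1}(i))$ for all $a$; (4) if $a^*$ is optimal and $\alpha(a(k)) = \alpha(a^*(k))$, then $v(a,k) \ge v(a^*,k)$. It is document-based if $v(a,k)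 = \alpha(a(k))\,\mathbf{1}\{k \le K\}$. The expected regret is $R_n = n \max_a \sum_{k=1}^K v(a,k) - \mathbb{E}\big[\sum_{t=1}^n \sum_{i=1}^L C_{ti}\big]$. Then for every algorithm there is a ranking problem, in fact a document-based one in which the clicks $C_{t1}, \dots, C_{tL}$ are independent given $A_t$, such that $$R_n \ge \frac{\sqrt{KLn}}{16\sqrt{2}}.$$ (Semi-bandits on $m$-sets, $m = K$.) Suppose that in each round $t$ the learner chooses a $K$-element set $S_t \subseteq [L]$, possibly at random, as a function of the past choices and observations, and observes $X_{ti}$ for $i \in S_t$, where the reward vectors $X_t \in \{0,1\}^L$ are i.i.d. with law $D$, $X_t$ being independent of the past and of $S_t$. Then for every algorithm there is a law $D$ with independent coordinates such that $$n \max_{|S| = K} \sum_{i \in S} \mathbb{E}[X_{1i}] - \mathbb{E}\Big[\sum_{t=1}^n \sum_{i \in S_t} X_{ti}\Big] \ge \frac{\sqrt{KLn}}{16\sqrt{2}}.$$ -/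

import Mathlib

namespace OnlineRanking

/-! ### Sequential interaction of a learner with a stochastic environment -/

/-- A (possibly randomised) algorithm with action set `A` and observation
set `O`: in every round it chooses the law of its next action as a function of everything that
happened so far, that is of the actions and observations of the previous `t` rounds. -/
abbrev Policy (A O : Type) : Type := (t : ℕ) → (Fin t → A × O) → PMF A

/-- The joint law of actions and observations of the first `t` rounds, when the policy `π`
interacts with an environment that answers an action `a`, independently of the past given `a`,
with an observation of law `env a`. -/
noncomputable def interactionLaw {A O : Type} (π : Policy A O) (env : A → PMF O) :
    (t : ℕ) → PMF (Fin t → A × O)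
  | 0 => PMF.pure Fin.elim0
  | t + 1 => (interactionLaw π env t).bind fun h =>
      (π t h).bind fun a => (env a).bind fun o => PMF.pure (Fin.snoc h (a, o))

/-- `𝔼[∑ₜ r (Aₜ, Oₜ)]`, the sum over the first `n` rounds. -/
noncomputable def expectedReturn {A O : Type} [Fintype A] [Fintype O]
    (π : Policy A O) (env : A → PMF O) (r : A → O → ℝ) (n : ℕ) : ℝ :=
  ∑ h : Fin n → A × O, (interactionLaw π env n h).toReal * ∑ t : Fin n, r (h t).1 (h t).2

/-- The coordinates of a random binary vector of law `p` are independent. -/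
def IndependentCoordinates {L : ℕ} (p : PMF (Fin L → Bool)) : Prop :=
  ∀ c : Fin L → Bool, p c = ∏ i : Fin L, p.map (fun x => x i) (c i)

/-- The probability that coordinate `i` of a random binary vector of law `p` equals one. -/
noncomputable def coordMean {L : ℕ} (p : PMF (Fin L → Bool)) (i : Fin L) : ℝ :=
  (p.map (fun x => x i) true).toReal

/-! ### Ranking problems -/

/-- Actions are permutations of the `L` items: `a k` is the item placed at position `k`,
`a.symm i` the position of item `i`.  Items and positions are numbered from `0`, so that the
positions visible to the user are those with `(k : ℕ) < K`. -/
abbrev Ranking (L : ℕ) : Type := Equiv.Perm (Fin L)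

/-- The click vector: `c i = true` if the user clicked on item `i`. -/
abbrev Clicks (L : ℕ) : Type := Fin L → Bool

/-- `v (a, k)`: the probability of a click on position `k`, that is on item `a k`, when the ranking
`a` is shown and the click vector has law `law a`. -/
noncomputable def clickProb {L : ℕ} (law : Ranking L → PMF (Clicks L)) (a : Ranking L)
    (k : Fin L) : ℝ :=
  coordMean (law a) (a k)

/-- `a` is optimal for the attractiveness function `α`: each of the first `K` positions holds a
most attractive item among those at this or a later position. -/
def IsOptimal {L : ℕ} (K : ℕ) (α : Fin L → ℝ) (a : Ranking L) : Prop :=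
  ∀ k : Fin L, (k : ℕ) < K → ∀ k' : Fin L, k ≤ k' → α (a k') ≤ α (a k)

/-- A sum over the visible positions. -/
def topSum {L : ℕ} (K : ℕ) (f : Fin L → ℝ) : ℝ :=
  ∑ k : Fin L, if (k : ℕ) < K then f k else 0

/-- A stochastic ranking problem with `L` items and `K` visible positions.  In every round the click
vector depends on the past only through the ranking shown; clicks within a round may be
dependent. -/
structure RankingProblem (L K : ℕ) where
  /-- The joint law of the clicks on all items, given the ranking. -/
  clickLaw : Ranking L → PMF (Clicks L)
  /-- The attractiveness function. -/
  α : Fin L → ℝ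
  α_mem : ∀ i, α i ∈ Set.Icc (0 : ℝ) 1
  /-- The user does not click on items that are not visible. -/
  click_zero : ∀ (a : Ranking L) (k : Fin L), K ≤ (k : ℕ) → clickProb clickLaw a k = 0
  /-- Optimal rankings maximise the expected number of clicks. -/
  optimal_max : ∀ aOpt : Ranking L, IsOptimal K α aOpt →
    ∀ a : Ranking L, topSum K (clickProb clickLaw a) ≤ topSum K (clickProb clickLaw aOpt)
  /-- Exchanging `i` with a less attractive `j` decreases the click probability at the position of
  `i` at least by the factor `α j / α i`.  (The ratio is multiplied out.) -/
  exchange : ∀ (i j : Fin L), α j ≤ α i → ∀ a : Ranking L,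
    α i * clickProb clickLaw (Equiv.swap i j * a) (a.symm i)
      ≤ α j * clickProb clickLaw a (a.symm i)
  /-- A position that holds an item as attractive as in an optimal ranking is at least as likely to
  be clicked as in the optimal ranking. -/
  lowest_exam : ∀ (a aOpt : Ranking L), IsOptimal K α aOpt →
    ∀ k : Fin L, α (a k) = α (aOpt k) → clickProb clickLaw aOpt k ≤ clickProb clickLaw a k

/-- The document-based model: a visible item is clicked with probability its attractiveness. -/
def RankingProblem.IsDocumentBased {L K : ℕ} (P : RankingProblem L K) : Prop :=
  ∀ (a : Ranking L) (k : Fin L),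
    clickProb P.clickLaw a k = if (k : ℕ) < K then P.α (a k) else 0

/-- The expected regret over `n` rounds,
`n * max_a ∑_{k < K} v (a, k) - 𝔼[∑ₜ ∑ᵢ Cₜᵢ]`.  (The supremum is over a finite nonempty set.) -/
noncomputable def RankingProblem.regret {L K : ℕ} (P : RankingProblem L K)
    (π : Policy (Ranking L) (Clicks L)) (n : ℕ) : ℝ :=
  n * (⨆ a : Ranking L, topSum K (clickProb P.clickLaw a))
    - expectedReturn π P.clickLaw (fun _ c => ∑ i : Fin L, if c i = true then (1 : ℝ) else 0) n

/-! ### Combinatorial semi-bandits on `m`-sets -/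

/-- The actions of the `m`-set problem: the subsets of size `m` of the `L` items. -/
abbrev MSet (L m : ℕ) : Type := {S : Finset (Fin L) // S.card = m}

/-- Semi-bandit feedback: the rewards of the chosen items are observed, the others are not. -/
abbrev SemiFeedback (L : ℕ) : Type := Fin L → Option Bool

/-- The law of the feedback to the action `S` when the reward vector has law `D`. -/
noncomputable def semiBanditEnv {L m : ℕ} (D : PMF (Fin L → Bool)) (S : MSet L m) :
    PMF (SemiFeedback L) :=
  D.map fun x i => if i ∈ S.1 then some (x i) else none

/-- The expected regret over `n` rounds when the reward vectors of the rounds are i.i.d. of law `D`: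
`n * max_S ∑_{i ∈ S} 𝔼[Xᵢ] - 𝔼[∑ₜ ∑_{i ∈ Sₜ} Xₜᵢ]`. -/
noncomputable def semiBanditRegret {L m : ℕ} (D : PMF (Fin L → Bool))
    (π : Policy (MSet L m) (SemiFeedback L)) (n : ℕ) : ℝ :=
  n * (⨆ S : MSet L m, ∑ i ∈ S.1, coordMean D i)
    - expectedReturn π (semiBanditEnv D)
        (fun S o => ∑ i ∈ S.1, if o i = some true then (1 : ℝ) else 0) n

end OnlineRanking

/-!
The proof randomises over document-based instances. The `L = N * K` items are arranged in `K`
blocks of `N`; in each block one special item has attractiveness `1 / 2 + ε / 2`, the others have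
attractiveness `1 / 2`, where `ε = √(N / n) / 2`. Showing the `K` special items is optimal, so the
regret is `ε / 2` times the number of times that special items are not shown, and it suffices to
prove that, on average over the choice of the special items, a constant fraction of these
`n * K` opportunities is missed.

For a single block, fix the special items of the other blocks and compare with the environment in
which the block has no special item. The relative entropy between the two laws of the history is
about `ε ^ 2 / 2` times the expected number of times that the special item is shown, and Pinsker's
inequality turns this into a bound on the change of that number. Averaged over the `N` positions of
the special item this is small, provided that the items of the block are shown `O(n)` times
altogether. A learner is free to show many items of the same block at once, so the latter may fail;
therefore the history is stopped once the items of the block have been shown `n` times, which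
overshoots by at most `K ≤ n` (`sum_stoppedShownCount_le`). The change of measure up to the
stopping time is `expect_stoppedCount_le`, and the bound for one block is
`le_sum_sub_stoppedShownCount`. Stopping costs only a factor of `2` in the regret: as exactly `K`
items are shown per round, a block that is stopped early has had many ordinary items shown, each
displacing a special one (`sum_sub_stoppedShownCount_le`).

The argument only uses that the observations of the items shown are independent Bernoulli
variables and that the other observations carry no information. This covers both click feedback
and semi-bandit feedback (`itemEnv`), so that `exists_means_regret_ge` gives both parts.
-/

namespace OnlineRanking

/-! ### Expectations under finitely supported laws -/

/-- The expectation of a real function under a law on a finite type, as a finite sum. -/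
noncomputable def expect {α : Type} [Fintype α] (p : PMF α) (f : α → ℝ) : ℝ :=
  ∑ x, (p x).toReal * f x

section Expect

variable {α β : Type} [Fintype α] [Fintype β]

lemma sum_coe (p : PMF α) : ∑ x, p x = 1 := by
  rw [← p.tsum_coe, tsum_fintype]

lemma sum_toReal (p : PMF α) : ∑ x, (p x).toReal = 1 := by
  rw [← ENNReal.toReal_sum (fun x _ => p.apply_ne_top x), sum_coe, ENNReal.toReal_one]

lemma expect_const (p : PMF α) (c : ℝ) : expect p (fun _ => c) = c := by
  rw [expect, ← Finset.sum_mul, sum_toReal, one_mul]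

lemma expect_add (p : PMF α) (f g : α → ℝ) :
    expect p (fun x => f x + g x) = expect p f + expect p g := by
  simp only [expect, mul_add, Finset.sum_add_distrib]

lemma expect_sub (p : PMF α) (f g : α → ℝ) :
    expect p (fun x => f x - g x) = expect p f - expect p g := by
  simp only [expect, mul_sub, Finset.sum_sub_distrib]

lemma expect_const_mul (p : PMF α) (c : ℝ) (f : α → ℝ) :
    expect p (fun x => c * f x) = c * expect p f := by
  simp only [expect, Finset.mul_sum]
  exact Finset.sum_congr rfl fun x _ => by ring

lemma expect_sum {ι : Type} (p : PMF α) (s : Finset ι) (f : ι → α → ℝ) :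
    expect p (fun x => ∑ i ∈ s, f i x) = ∑ i ∈ s, expect p (f i) := by
  simp only [expect, Finset.mul_sum]
  exact Finset.sum_comm

lemma expect_mono (p : PMF α) {f g : α → ℝ} (h : ∀ x, f x ≤ g x) : expect p f ≤ expect p g :=
  Finset.sum_le_sum fun x _ => mul_le_mul_of_nonneg_left (h x) ENNReal.toReal_nonneg

lemma expect_pure (a : α) (f : α → ℝ) : expect (PMF.pure a) f = f a := by
  classical
  rw [expect, Finset.sum_eq_single a]
  · simp
  · intro b _ hb
    simp [PMF.pure_apply, hb]
  · simp

lemma expect_bind (p : PMF α) (q : α → PMF β) (f : β → ℝ) :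
    expect (p.bind q) f = expect p (fun x => expect (q x) f) := by
  have h : ∀ y, ((p.bind q) y).toReal = ∑ x, (p x).toReal * (q x y).toReal := by
    intro y
    rw [PMF.bind_apply, tsum_fintype, ENNReal.toReal_sum]
    · simp only [ENNReal.toReal_mul]
    · exact fun x _ => ENNReal.mul_ne_top (p.apply_ne_top x) ((q x).apply_ne_top y)
  simp only [expect, h, Finset.sum_mul, Finset.mul_sum]
  rw [Finset.sum_comm]
  exact Finset.sum_congr rfl fun x _ => Finset.sum_congr rfl fun y _ => by ring

lemma expect_map (p : PMF α) (g : α → β) (f : β → ℝ) :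
    expect (p.map g) f = expect p (fun x => f (g x)) := by
  rw [← PMF.bind_pure_comp, expect_bind]
  simp only [Function.comp, expect_pure]

end Expect

/-! ### Pinsker's inequality -/

/-- The pointwise inequality behind Pinsker's inequality.  The difference of the two sides of
`3 (x - 1) ^ 2 / (4 x + 2) ≤ x - 1 - log x` has derivative `(x - 1) ^ 3 / (x (2 x + 1) ^ 2)`. -/
lemma three_mul_sub_one_sq_le {x : ℝ} (hx : 0 < x) :
    3 * (x - 1) ^ 2 ≤ (4 * x + 2) * (x - 1 - Real.log x) := by
  let g : ℝ → ℝ := fun y => y - 1 - Real.log y - 3 * (y - 1) ^ 2 / (4 * y + 2)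
  have hg : ∀ y : ℝ, 0 < y → HasDerivAt g ((y - 1) ^ 3 / (y * (2 * y + 1) ^ 2)) y := by
    intro y hy
    have h1 : HasDerivAt (fun y : ℝ => y - 1) 1 y := (hasDerivAt_id y).sub_const 1
    have h2 := Real.hasDerivAt_log hy.ne'
    have h3 : HasDerivAt (fun y : ℝ => 4 * y + 2) (4 * 1) y :=
      ((hasDerivAt_id y).const_mul 4).add_const 2
    have h4 := (((h1.pow 2).const_mul 3).div h3 (by positivity))
    have h5 := (h1.sub h2).sub h4
    refine h5.congr_deriv ?_
    have : 2 * y + 1 ≠ 0 := by positivity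
    have : 4 * y + 2 ≠ 0 := by positivity
    simp only [Pi.pow_apply, Nat.cast_ofNat, pow_one, Nat.add_one_sub_one]
    field_simp
    ring
  have hg1 : g 1 = 0 := by simp [g]
  have key : 0 ≤ g x := by
    rcases le_total 1 x with h | h
    · have hmono : MonotoneOn g (Set.Ici 1) := by
        refine monotoneOn_of_deriv_nonneg (convex_Ici 1)
          (fun y hy => (hg y (lt_of_lt_of_le one_pos hy)).continuousAt.continuousWithinAt)
          (fun y hy => ?_) (fun y hy => ?_)
        · rw [interior_Ici] at hy
          exact (hg y (one_pos.trans hy)).differentiableAt.differentiableWithinAt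
        · rw [interior_Ici] at hy
          have hy' : (1 : ℝ) < y := hy
          rw [(hg y (one_pos.trans hy)).deriv]
          have : 0 < y - 1 := by linarith
          positivity
      rw [← hg1]
      exact hmono Set.self_mem_Ici h h
    · have hanti : AntitoneOn g (Set.Ioc 0 1) := by
        refine antitoneOn_of_deriv_nonpos (convex_Ioc 0 1)
          (fun y hy => (hg y hy.1).continuousAt.continuousWithinAt)
          (fun y hy => ?_) (fun y hy => ?_)
        · rw [interior_Ioc] at hy
          exact (hg y hy.1).differentiableAt.differentiableWithinAt
        · rw [interior_Ioc] at hy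
          have hy0 : 0 < y := hy.1
          rw [(hg y hy.1).deriv]
          refine div_nonpos_of_nonpos_of_nonneg ?_ (by positivity)
          have : y - 1 ≤ 0 := by linarith [hy.2]
          exact Odd.pow_nonpos (by decide) this
      rw [← hg1]
      exact hanti ⟨hx, h⟩ ⟨one_pos, le_rfl⟩ h
  have h42 : 0 < 4 * x + 2 := by positivity
  have : 3 * (x - 1) ^ 2 / (4 * x + 2) ≤ x - 1 - Real.log x := by
    simp only [g] at key
    linarith
  rw [div_le_iff₀ h42] at this
  linarith

/-- Pinsker's inequality, for a law with density `exp ℓ` with respect to `p` and a function with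
values in `[0, b]`.  Here `-expect p ℓ` is the relative entropy of `p` with respect to the law of
density `exp ℓ`. -/
lemma expect_exp_mul_le {α : Type} [Fintype α] (p : PMF α) (ℓ f : α → ℝ) {b : ℝ}
    (hℓ : expect p (fun x => Real.exp (ℓ x)) = 1) (hf0 : ∀ x, 0 ≤ f x) (hfb : ∀ x, f x ≤ b) :
    expect p (fun x => Real.exp (ℓ x) * f x) ≤ expect p f + b * √(-expect p ℓ / 2) := by
  set w : α → ℝ := fun x => (p x).toReal
  have hw : ∀ x, 0 ≤ w x := fun x => ENNReal.toReal_nonneg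
  have hb : 0 ≤ b := by
    obtain ⟨x, -⟩ := p.support_nonempty
    exact (hf0 x).trans (hfb x)
  -- the total variation distance, bounded by Cauchy-Schwarz
  have hcs : expect p (fun x => |Real.exp (ℓ x) - 1|) ^ 2 ≤ 2 * -expect p ℓ := by
    have h := Finset.sum_sq_le_sum_mul_sum_of_sq_le_mul Finset.univ
      (r := fun x => w x * |Real.exp (ℓ x) - 1|)
      (f := fun x => w x * ((4 * Real.exp (ℓ x) + 2) / 3))
      (g := fun x => w x * (Real.exp (ℓ x) - 1 - ℓ x))
      (fun x _ => mul_nonneg (hw x) (by positivity))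
      (fun x _ => mul_nonneg (hw x) (by linarith [Real.add_one_le_exp (ℓ x)]))
      (fun x _ => by
        have h3 := three_mul_sub_one_sq_le (Real.exp_pos (ℓ x))
        rw [Real.log_exp] at h3
        rw [mul_pow, sq_abs]
        have := mul_le_mul_of_nonneg_left h3 (sq_nonneg (w x))
        nlinarith [this])
    have h1 : ∑ x, w x * ((4 * Real.exp (ℓ x) + 2) / 3) = 2 := by
      have : expect p (fun x => 4 / 3 * Real.exp (ℓ x) + 2 / 3) = 2 := by
        rw [expect_add, expect_const_mul, expect_const, hℓ]
        norm_num
      refine Eq.trans (Finset.sum_congr rfl fun x _ => ?_) this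
      simp only [w]
      ring
    have h2 : ∑ x, w x * (Real.exp (ℓ x) - 1 - ℓ x) = -expect p ℓ := by
      have : expect p (fun x => Real.exp (ℓ x) - 1 - ℓ x) = -expect p ℓ := by
        rw [expect_sub, expect_sub, expect_const, hℓ]
        ring
      exact this
    rw [h1, h2] at h
    exact h
  have htv : expect p (fun x => |Real.exp (ℓ x) - 1|) ≤ 2 * √(-expect p ℓ / 2) := by
    have : 2 * -expect p ℓ = 2 ^ 2 * (-expect p ℓ / 2) := by ring
    rw [this] at hcs
    calc expect p (fun x => |Real.exp (ℓ x) - 1|)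
        ≤ √(2 ^ 2 * (-expect p ℓ / 2)) := Real.le_sqrt_of_sq_le hcs
      _ = 2 * √(-expect p ℓ / 2) := by
        rw [Real.sqrt_mul (by positivity), Real.sqrt_sq (by norm_num)]
  -- centring `f` at `b / 2` halves the bound
  have hpt : ∀ x, Real.exp (ℓ x) * f x - f x
      ≤ b / 2 * |Real.exp (ℓ x) - 1| + b / 2 * (Real.exp (ℓ x) - 1) := by
    intro x
    have h1 : |f x - b / 2| ≤ b / 2 := abs_le.2 ⟨by linarith [hf0 x], by linarith [hfb x]⟩
    have h2 : (f x - b / 2) * (Real.exp (ℓ x) - 1) ≤ b / 2 * |Real.exp (ℓ x) - 1| := by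
      refine (le_abs_self _).trans ?_
      rw [abs_mul]
      exact mul_le_mul_of_nonneg_right h1 (abs_nonneg _)
    linarith
  have h := expect_mono p hpt
  rw [expect_sub, expect_add, expect_const_mul, expect_const_mul, expect_sub, expect_const, hℓ]
    at h
  nlinarith [mul_le_mul_of_nonneg_left htv hb]

/-! ### Products of laws -/

section Product

variable {ι : Type} [Fintype ι] [DecidableEq ι] {β γ : Type} [Fintype β] [Fintype γ]

/-- The law of a family of independent random variables, the `i`-th one of law `p i`. -/
noncomputable def prodLaw (p : ι → PMF β) : PMF (ι → β) :=
  PMF.ofFintype (fun x => ∏ i, p i (x i)) (by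
    classical
    have h := Finset.prod_univ_sum (fun _ : ι => (Finset.univ : Finset β)) (fun i b => p i b)
    rw [Fintype.piFinset_univ] at h
    rw [← h]
    exact Finset.prod_eq_one fun i _ => sum_coe (p i))

lemma prodLaw_apply (p : ι → PMF β) (x : ι → β) : prodLaw p x = ∏ i, p i (x i) := rfl

lemma map_apply_eq_sum {α δ : Type} [Fintype α] [DecidableEq δ] (p : PMF α) (g : α → δ) (b : δ) :
    p.map g b = ∑ x, if b = g x then p x else 0 := by
  rw [PMF.map_apply, tsum_fintype]
  exact Finset.sum_congr rfl fun x _ => by congr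

/-- Applying a map to each coordinate preserves product laws. -/
lemma prodLaw_map (p : ι → PMF β) (g : ι → β → γ) :
    (prodLaw p).map (fun x i => g i (x i)) = prodLaw (fun i => (p i).map (g i)) := by
  classical
  ext y
  have h := Finset.prod_univ_sum (fun _ : ι => (Finset.univ : Finset β))
    (fun i b => if y i = g i b then p i b else 0)
  rw [Fintype.piFinset_univ] at h
  rw [map_apply_eq_sum, prodLaw_apply]
  simp only [map_apply_eq_sum]
  rw [h]
  refine Finset.sum_congr rfl fun x _ => ?_
  rw [prodLaw_apply]
  split_ifs with hy
  · subst hy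
    simp
  · obtain ⟨i, hi⟩ := Function.ne_iff.1 hy
    exact (Finset.prod_eq_zero (Finset.mem_univ i) (if_neg hi)).symm

/-- The marginals of a product law. -/
lemma prodLaw_map_eval (p : ι → PMF β) (i : ι) : (prodLaw p).map (fun x => x i) = p i := by
  classical
  ext b
  have h := Finset.prod_univ_sum (fun _ : ι => (Finset.univ : Finset β))
    (fun k c => if k = i then (if b = c then p k c else 0) else p k c)
  rw [Fintype.piFinset_univ] at h
  rw [map_apply_eq_sum]
  calc ∑ x, (if b = x i then prodLaw p x else 0)
      = ∑ x : ι → β, ∏ k, (if k = i then (if b = x k then p k (x k) else 0) else p k (x k)) := by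
        refine Finset.sum_congr rfl fun x _ => ?_
        rw [prodLaw_apply]
        split_ifs with hb
        · refine Finset.prod_congr rfl fun k _ => ?_
          split_ifs with hk hk'
          · rfl
          · subst hk; exact absurd hb hk'
          · rfl
        · exact (Finset.prod_eq_zero (Finset.mem_univ i) (by simp [hb])).symm
    _ = p i b := by
        rw [← h, Finset.prod_eq_single i]
        · simp
        · intro k _ hk
          simp only [hk, if_false]
          exact sum_coe (p k)
        · simp

end Product

/-! ### Functionals of the interaction -/

section Interaction

variable {A O : Type} [Fintype A] [Fintype O]

lemma expectedReturn_eq_expect (π : Policy A O) (env : A → PMF O) (r : A → O → ℝ) (n : ℕ) :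
    expectedReturn π env r n
      = expect (interactionLaw π env n) fun h => ∑ t : Fin n, r (h t).1 (h t).2 := rfl

lemma expect_interactionLaw_zero (π : Policy A O) (env : A → PMF O)
    (φ : (Fin 0 → A × O) → ℝ) : expect (interactionLaw π env 0) φ = φ Fin.elim0 :=
  expect_pure _ _

lemma expect_interactionLaw_succ (π : Policy A O) (env : A → PMF O) (t : ℕ)
    (φ : (Fin (t + 1) → A × O) → ℝ) :
    expect (interactionLaw π env (t + 1)) φ
      = expect (interactionLaw π env t) fun h =>
          expect (π t h) fun a => expect (env a) fun o => φ (Fin.snoc h (a, o)) := by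
  rw [interactionLaw, expect_bind]
  simp only [expect_bind, expect_pure]

end Interaction

/-- The functional `∑ₜ g t (h₀, …, hₜ₋₁) hₜ` of a history `h`: in each round, an increment that
depends on the past is accumulated. -/
def accum {X : Type} (g : ∀ t, (Fin t → X) → X → ℝ) : ∀ t, (Fin t → X) → ℝ
  | 0, _ => 0
  | t + 1, h => accum g t (Fin.init h) + g t (Fin.init h) (h (Fin.last t))

section Accum

variable {X : Type}

lemma accum_snoc (g : ∀ t, (Fin t → X) → X → ℝ) (t : ℕ) (h : Fin t → X) (x : X) :
    accum g (t + 1) (Fin.snoc h x : Fin (t + 1) → X) = accum g t h + g t h x := by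
  rw [accum, Fin.init_snoc, Fin.snoc_last]

lemma accum_eq_sum (f : X → ℝ) (t : ℕ) (h : Fin t → X) :
    accum (fun _ _ => f) t h = ∑ s, f (h s) := by
  induction t with
  | zero => simp [accum]
  | succ t ih =>
    rw [accum, ih, Fin.sum_univ_castSucc]
    rfl

lemma accum_nonneg {g : ∀ t, (Fin t → X) → X → ℝ} (hg : ∀ t h x, 0 ≤ g t h x) (t : ℕ)
    (h : Fin t → X) : 0 ≤ accum g t h := by
  induction t with
  | zero => exact le_rfl
  | succ t ih => exact add_nonneg (ih _) (hg _ _ _)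

lemma accum_le {g : ∀ t, (Fin t → X) → X → ℝ} (hg : ∀ t h x, g t h x ≤ 1) (t : ℕ)
    (h : Fin t → X) : accum g t h ≤ t := by
  induction t with
  | zero => simp [accum]
  | succ t ih =>
    rw [accum]
    push_cast
    exact add_le_add (ih _) (hg _ _ _)

end Accum

lemma expect_accum_succ {A O : Type} [Fintype A] [Fintype O] (π : Policy A O) (env : A → PMF O)
    (g : ∀ t, (Fin t → A × O) → A × O → ℝ) (t : ℕ) :
    expect (interactionLaw π env (t + 1)) (accum g (t + 1))
      = expect (interactionLaw π env t) (accum g t)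
        + expect (interactionLaw π env t) fun h =>
            expect (π t h) fun a => expect (env a) fun o => g t h (a, o) := by
  rw [expect_interactionLaw_succ, ← expect_add]
  simp only [accum_snoc, expect_add, expect_const]

/-! ### Change of measure up to a stopping time -/

section ChangeOfMeasure

open Classical in
/-- The number of rounds with an action in `U`, up to the end of the time during which `act`
holds. -/
noncomputable def stoppedCount {A O : Type} (act : ∀ t, (Fin t → A × O) → Prop) (U : A → Prop) :
    ∀ t, (Fin t → A × O) → ℝ :=
  accum fun t h x => if act t h ∧ U x.1 then 1 else 0

open Classical in
/-- The logarithm of the likelihood ratio of two environments with likelihood ratio `ρ` in each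
round, stopped at the end of the time during which `act` holds. -/
noncomputable def stoppedLogLik {A O : Type} (act : ∀ t, (Fin t → A × O) → Prop)
    (ρ : A → O → ℝ) : ∀ t, (Fin t → A × O) → ℝ :=
  accum fun t h x => if act t h then Real.log (ρ x.1 x.2) else 0

variable {A O : Type} {act : ∀ t, (Fin t → A × O) → Prop} {U : A → Prop}

lemma stoppedCount_nonneg (t : ℕ) (h : Fin t → A × O) : 0 ≤ stoppedCount act U t h :=
  accum_nonneg (fun _ _ _ => by split_ifs <;> norm_num) t h

lemma stoppedCount_le (t : ℕ) (h : Fin t → A × O) : stoppedCount act U t h ≤ t :=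
  accum_le (fun _ _ _ => by split_ifs <;> norm_num) t h

variable [Fintype O] {ρ : A → O → ℝ} {ν ν' : A → PMF O}

lemma expect_tilt (hlik : ∀ a o, (ν' a o).toReal = (ν a o).toReal * ρ a o) (a : A) (f : O → ℝ) :
    expect (ν a) (fun o => ρ a o * f o) = expect (ν' a) f :=
  Finset.sum_congr rfl fun o _ => by rw [hlik, mul_assoc]

variable [Fintype A]

open Classical in
lemma expect_stoppedCount_succ (π : Policy A O) (env : A → PMF O) (t : ℕ) :
    expect (interactionLaw π env (t + 1)) (stoppedCount act U (t + 1))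
      = expect (interactionLaw π env t) (stoppedCount act U t)
        + expect (interactionLaw π env t) fun h =>
            expect (π t h) fun a => if act t h ∧ U a then 1 else 0 := by
  rw [stoppedCount, expect_accum_succ]
  exact congrArg _ (congrArg _ (funext fun h => congrArg _ (funext fun a =>
    expect_const (env a) (if act t h ∧ U a then (1 : ℝ) else 0))))

/-- On histories that have not been stopped, the law of the history in the environment `ν'` has
density `exp (stoppedLogLik act ρ)` with respect to its law in `ν`. -/
lemma expect_active (π : Policy A O)
    (hact : ∀ t h x, act (t + 1) (Fin.snoc h x : Fin (t + 1) → A × O) → act t h)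
    (hpos : ∀ a o, 0 < ρ a o)
    (hlik : ∀ a o, (ν' a o).toReal = (ν a o).toReal * ρ a o) (t : ℕ)
    (φ : (Fin t → A × O) → ℝ) (hφ : ∀ h, ¬ act t h → φ h = 0) :
    expect (interactionLaw π ν' t) φ
      = expect (interactionLaw π ν t) fun h => Real.exp (stoppedLogLik act ρ t h) * φ h := by
  induction t with
  | zero => simp [expect_interactionLaw_zero, stoppedLogLik, accum]
  | succ t ih =>
    rw [expect_interactionLaw_succ, expect_interactionLaw_succ, ih]
    · refine congrArg _ (funext fun h => ?_)
      rw [← expect_const_mul]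
      refine congrArg _ (funext fun a => ?_)
      rw [← expect_tilt hlik, ← expect_const_mul]
      refine congrArg _ (funext fun o => ?_)
      by_cases hh : act t h
      · rw [stoppedLogLik, accum_snoc, if_pos hh, Real.exp_add, Real.exp_log (hpos a o)]
        ring
      · rw [hφ _ fun h' => hh (hact t h (a, o) h')]
        ring
    · intro h hh
      have : ∀ a o, φ (Fin.snoc h (a, o)) = 0 := fun a o => hφ _ fun h' => hh (hact t h (a, o) h')
      simp only [this, expect_const]

lemma expect_exp_stoppedLogLik (π : Policy A O) (hpos : ∀ a o, 0 < ρ a o)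
    (hlik : ∀ a o, (ν' a o).toReal = (ν a o).toReal * ρ a o) (t : ℕ) :
    expect (interactionLaw π ν t) (fun h => Real.exp (stoppedLogLik act ρ t h)) = 1 := by
  induction t with
  | zero => simp [expect_interactionLaw_zero, stoppedLogLik, accum]
  | succ t ih =>
    rw [expect_interactionLaw_succ, ← ih]
    refine congrArg _ (funext fun h => ?_)
    by_cases hh : act t h
    · have : ∀ a o, Real.exp (stoppedLogLik act ρ (t + 1) (Fin.snoc h (a, o)))
          = Real.exp (stoppedLogLik act ρ t h) * (ρ a o * 1) := fun a o => by
        rw [stoppedLogLik, accum_snoc, if_pos hh, Real.exp_add, Real.exp_log (hpos a o), mul_one]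
      simp only [this, expect_const_mul, expect_tilt hlik, expect_const]
      rw [mul_one]
    · have : ∀ a o, Real.exp (stoppedLogLik act ρ (t + 1) (Fin.snoc h (a, o)))
          = Real.exp (stoppedLogLik act ρ t h) := fun a o => by
        rw [stoppedLogLik, accum_snoc, if_neg hh, add_zero]
      simp only [this, expect_const]

/-- The stopped count depends on the stopped history only, so its expectation in `ν'` can be
computed in `ν` with the stopped likelihood ratio. -/
lemma expect_stoppedCount_eq (π : Policy A O)
    (hact : ∀ t h x, act (t + 1) (Fin.snoc h x : Fin (t + 1) → A × O) → act t h)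
    (hpos : ∀ a o, 0 < ρ a o)
    (hlik : ∀ a o, (ν' a o).toReal = (ν a o).toReal * ρ a o) (t : ℕ) :
    expect (interactionLaw π ν' t) (stoppedCount act U t)
      = expect (interactionLaw π ν t) fun h =>
          Real.exp (stoppedLogLik act ρ t h) * stoppedCount act U t h := by
  classical
  induction t with
  | zero => simp [expect_interactionLaw_zero, stoppedCount, accum]
  | succ t ih =>
    rw [expect_stoppedCount_succ, ih, expect_active π hact hpos hlik t, ← expect_add,
      expect_interactionLaw_succ]
    · refine congrArg _ (funext fun h => ?_)
      by_cases hh : act t h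
      · have : ∀ a o, Real.exp (stoppedLogLik act ρ (t + 1) (Fin.snoc h (a, o)))
              * stoppedCount act U (t + 1) (Fin.snoc h (a, o))
            = Real.exp (stoppedLogLik act ρ t h)
              * (ρ a o * (stoppedCount act U t h + if act t h ∧ U a then 1 else 0)) := by
          intro a o
          rw [stoppedLogLik, stoppedCount, accum_snoc, accum_snoc, if_pos hh, Real.exp_add,
            Real.exp_log (hpos a o)]
          ring
        simp only [this, expect_const_mul, expect_tilt hlik, expect_const, expect_add]
        ring
      · have : ∀ a o, Real.exp (stoppedLogLik act ρ (t + 1) (Fin.snoc h (a, o)))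
              * stoppedCount act U (t + 1) (Fin.snoc h (a, o))
            = Real.exp (stoppedLogLik act ρ t h) * stoppedCount act U t h := by
          intro a o
          rw [stoppedLogLik, stoppedCount, accum_snoc, accum_snoc, if_neg hh,
            if_neg fun h' => hh h'.1, add_zero, add_zero]
        simp only [this, expect_const, hh, false_and, if_false, mul_zero, add_zero]
    · intro h hh
      simp only [hh, false_and, if_false, expect_const]

/-- If the environments differ only after actions in `U`, with relative entropy `κ`, then the
relative entropy of the laws of the stopped histories is `κ` times the expected number of such
actions. -/
lemma expect_stoppedLogLik (π : Policy A O) {κ : ℝ} (hone : ∀ a o, ¬ U a → ρ a o = 1)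
    (hκ : ∀ a, U a → expect (ν a) (fun o => Real.log (ρ a o)) = -κ) (t : ℕ) :
    expect (interactionLaw π ν t) (stoppedLogLik act ρ t)
      = -κ * expect (interactionLaw π ν t) (stoppedCount act U t) := by
  classical
  induction t with
  | zero => simp [expect_interactionLaw_zero, stoppedCount, stoppedLogLik, accum]
  | succ t ih =>
    rw [stoppedLogLik, expect_accum_succ, expect_stoppedCount_succ, ← stoppedLogLik, ih, mul_add,
      ← expect_const_mul _ (-κ) (fun h => expect (π t h) _)]
    refine congrArg _ (congrArg _ (funext fun h => ?_))
    rw [← expect_const_mul]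
    refine congrArg _ (funext fun a => ?_)
    by_cases hh : act t h
    · by_cases ha : U a
      · simp only [hh, ha, and_self, if_true, hκ a ha, mul_one]
      · simp only [hh, ha, and_false, if_true, if_false, expect_const, hone a _ ha, Real.log_one,
          mul_zero]
    · simp only [hh, false_and, if_false, expect_const, mul_zero]

lemma expect_stoppedCount_le (π : Policy A O) {κ : ℝ}
    (hact : ∀ t h x, act (t + 1) (Fin.snoc h x : Fin (t + 1) → A × O) → act t h)
    (hpos : ∀ a o, 0 < ρ a o)
    (hlik : ∀ a o, (ν' a o).toReal = (ν a o).toReal * ρ a o)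
    (hone : ∀ a o, ¬ U a → ρ a o = 1)
    (hκ : ∀ a, U a → expect (ν a) (fun o => Real.log (ρ a o)) = -κ) (n : ℕ) :
    expect (interactionLaw π ν' n) (stoppedCount act U n)
      ≤ expect (interactionLaw π ν n) (stoppedCount act U n)
        + n * √(κ / 2 * expect (interactionLaw π ν n) (stoppedCount act U n)) := by
  rw [expect_stoppedCount_eq π hact hpos hlik]
  refine (expect_exp_mul_le _ _ _ (expect_exp_stoppedLogLik π hpos hlik n)
    (stoppedCount_nonneg n) (stoppedCount_le n)).trans_eq ?_
  rw [expect_stoppedLogLik π hone hκ]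
  congr 3
  ring

end ChangeOfMeasure

/-! ### Counting how often an item is shown -/

section Counting

variable {A O I : Type} [DecidableEq I]

/-- The number of rounds in which item `i` is shown, when `S a` is the set of items shown by the
action `a`. -/
def shownCount (S : A → Finset I) (i : I) {t : ℕ} (h : Fin t → A × O) : ℝ :=
  ∑ s, if i ∈ S (h s).1 then 1 else 0

/-- In the first `t` rounds, the items of the block `B` have been shown fewer than `n` times
altogether. -/
def BlockActive (S : A → Finset I) (B : Finset I) (n : ℕ) (t : ℕ) (h : Fin t → A × O) : Prop :=
  ∑ i ∈ B, shownCount S i h < n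

/-- The number of rounds in which item `i` is shown, up to the round in which the items of the block
`B` have been shown `n` times altogether. -/
noncomputable def stoppedShownCount (S : A → Finset I) (B : Finset I) (n : ℕ) (i : I) :
    ∀ t, (Fin t → A × O) → ℝ :=
  stoppedCount (BlockActive S B n) fun a => i ∈ S a

variable {S : A → Finset I} {B : Finset I} {n : ℕ}

lemma shownCount_succ (i : I) {t : ℕ} (h : Fin (t + 1) → A × O) :
    shownCount S i h
      = shownCount S i (Fin.init h) + if i ∈ S (h (Fin.last t)).1 then 1 else 0 := by
  rw [shownCount, Fin.sum_univ_castSucc]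
  rfl

lemma shownCount_nonneg (i : I) {t : ℕ} (h : Fin t → A × O) : 0 ≤ shownCount S i h :=
  Finset.sum_nonneg fun _ _ => by split_ifs <;> norm_num

lemma shownCount_le (i : I) {t : ℕ} (h : Fin t → A × O) : shownCount S i h ≤ t := by
  refine (Finset.sum_le_sum (g := fun _ => (1 : ℝ)) fun _ _ => ?_).trans_eq (by simp)
  split_ifs <;> norm_num

lemma sum_mul_shownCount [Fintype I] (α : I → ℝ) {t : ℕ} (h : Fin t → A × O) :
    ∑ i, α i * shownCount S i h = ∑ s, ∑ i ∈ S (h s).1, α i := by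
  simp only [shownCount, Finset.mul_sum, mul_ite, mul_one, mul_zero]
  rw [Finset.sum_comm]
  exact Finset.sum_congr rfl fun s _ => by rw [Finset.sum_ite_mem, Finset.univ_inter]

lemma BlockActive.init {t : ℕ} {h : Fin (t + 1) → A × O} (hh : BlockActive S B n (t + 1) h) :
    BlockActive S B n t (Fin.init h) := by
  refine lt_of_le_of_lt (Finset.sum_le_sum fun i _ => ?_) hh
  rw [shownCount_succ]
  split_ifs <;> simp

lemma stoppedShownCount_succ_of_active (i : I) {t : ℕ} {h : Fin (t + 1) → A × O}
    (hh : BlockActive S B n t (Fin.init h)) :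
    stoppedShownCount S B n i (t + 1) h
      = stoppedShownCount S B n i t (Fin.init h)
        + if i ∈ S (h (Fin.last t)).1 then 1 else 0 := by
  classical
  rw [stoppedShownCount, stoppedCount, accum]
  simp only [hh, true_and]

lemma stoppedShownCount_succ_of_not_active (i : I) {t : ℕ} {h : Fin (t + 1) → A × O}
    (hh : ¬ BlockActive S B n t (Fin.init h)) :
    stoppedShownCount S B n i (t + 1) h = stoppedShownCount S B n i t (Fin.init h) := by
  rw [stoppedShownCount, stoppedCount, accum]
  simp only [hh, false_and, if_false, add_zero]

lemma stoppedShownCount_of_active (i : I) {t : ℕ} {h : Fin t → A × O}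
    (hh : BlockActive S B n t h) : stoppedShownCount S B n i t h = shownCount S i h := by
  induction t with
  | zero => simp [stoppedShownCount, stoppedCount, accum, shownCount]
  | succ t ih => rw [stoppedShownCount_succ_of_active i hh.init, ih hh.init, shownCount_succ]

lemma stoppedShownCount_le_shownCount (i : I) (t : ℕ) (h : Fin t → A × O) :
    stoppedShownCount S B n i t h ≤ shownCount S i h := by
  induction t with
  | zero => simp [stoppedShownCount, stoppedCount, accum, shownCount]
  | succ t ih =>
    rw [shownCount_succ]
    by_cases hh : BlockActive S B n t (Fin.init h)
    · rw [stoppedShownCount_succ_of_active i hh]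
      exact add_le_add_left (ih _) _
    · rw [stoppedShownCount_succ_of_not_active i hh]
      refine (ih _).trans (le_add_of_nonneg_right ?_)
      split_ifs <;> norm_num

/-- A round overshoots the stopping threshold by at most the number of items that it shows. -/
lemma sum_stoppedShownCount_le {k : ℕ} (hS : ∀ a, (S a).card ≤ k) (t : ℕ) (h : Fin t → A × O) :
    ∑ i ∈ B, stoppedShownCount S B n i t h ≤ n + k := by
  induction t with
  | zero =>
    have : (0 : ℝ) ≤ n + k := by positivity
    simpa [stoppedShownCount, stoppedCount, accum] using this
  | succ t ih =>
    by_cases hh : BlockActive S B n t (Fin.init h)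
    · simp only [stoppedShownCount_succ_of_active _ hh, stoppedShownCount_of_active _ hh,
        Finset.sum_add_distrib]
      refine add_le_add (le_of_lt hh) ?_
      rw [Finset.sum_ite_mem, Finset.sum_const, nsmul_one]
      exact_mod_cast (Finset.card_le_card Finset.inter_subset_right).trans (hS _)
    · simp only [stoppedShownCount_succ_of_not_active _ hh]
      exact ih _

lemma le_sum_stoppedShownCount {t : ℕ} {h : Fin t → A × O} (hh : ¬ BlockActive S B n t h) :
    (n : ℝ) ≤ ∑ i ∈ B, stoppedShownCount S B n i t h := by
  induction t with
  | zero => simpa [BlockActive, stoppedShownCount, stoppedCount, accum, shownCount] using hh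
  | succ t ih =>
    by_cases hi : BlockActive S B n t (Fin.init h)
    · simp only [stoppedShownCount_succ_of_active _ hi, stoppedShownCount_of_active _ hi,
        ← shownCount_succ]
      exact not_lt.1 hh
    · simp only [stoppedShownCount_succ_of_not_active _ hi]
      exact ih hi

/-- The two terms on the right count the rounds that do not show `i` and the showings of the other
items of the block. If the block is not stopped, the first one suffices; if it is, then so does the
second one, because the block has been shown at least `n` times. -/
lemma sub_stoppedShownCount_le {i : I} (hi : i ∈ B) (h : Fin n → A × O) :
    n - stoppedShownCount S B n i n h
      ≤ (n - shownCount S i h) + (∑ l ∈ B, shownCount S l h - shownCount S i h) := by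
  by_cases hh : BlockActive S B n n h
  · rw [stoppedShownCount_of_active i hh]
    have := Finset.single_le_sum (fun l _ => shownCount_nonneg (S := S) l h) hi
    linarith
  · have h1 := le_sum_stoppedShownCount hh
    have h2 := shownCount_le (S := S) i h
    have h3 := Finset.single_le_sum (f := fun l => shownCount S l h - stoppedShownCount S B n l n h)
      (fun l _ => sub_nonneg.2 (stoppedShownCount_le_shownCount l n h)) hi
    simp only [Finset.sum_sub_distrib] at h3
    linarith

end Counting

/-! ### One block of items -/

/-- The environments `ν' i` differ from `ν` only on rounds that show item `i`, and there by a
relative entropy `κ` that is too small to identify `i` among the items of the block `B`: on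
average over `i`, the item `i` is missed in a constant fraction of the rounds. -/
lemma le_sum_sub_stoppedShownCount {A O I : Type} [Fintype A] [Fintype O] [DecidableEq I]
    (π : Policy A O) {S : A → Finset I} {B : Finset I} {n : ℕ} {κ : ℝ}
    {ρ : I → A → O → ℝ} {ν : A → PMF O} {ν' : I → A → PMF O}
    (hS : ∀ a, (S a).card ≤ n) (hB : 8 ≤ B.card)
    (hpos : ∀ i a o, 0 < ρ i a o)
    (hlik : ∀ i ∈ B, ∀ a o, (ν' i a o).toReal = (ν a o).toReal * ρ i a o)
    (hone : ∀ i a o, i ∉ S a → ρ i a o = 1)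
    (hκ : ∀ i ∈ B, ∀ a, i ∈ S a → expect (ν a) (fun o => Real.log (ρ i a o)) = -κ)
    (hκ0 : 0 ≤ κ) (hκn : κ * n ≤ 31 / 200 * B.card) :
    √2 / 4 * (n * B.card)
      ≤ ∑ i ∈ B, expect (interactionLaw π (ν' i) n) fun h => n - stoppedShownCount S B n i n h := by
  set x : I → ℝ := fun i => expect (interactionLaw π ν n) (stoppedShownCount S B n i n) with hx
  have hx0 : ∀ i, 0 ≤ x i := fun i =>
    Finset.sum_nonneg fun h _ => mul_nonneg ENNReal.toReal_nonneg (stoppedCount_nonneg n h)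
  have hxsum : ∑ i ∈ B, x i ≤ 2 * n := by
    rw [hx, ← expect_sum]
    refine (expect_mono _ fun h => sum_stoppedShownCount_le hS n h).trans_eq ?_
    rw [expect_const]
    ring
  have hi : ∀ i ∈ B, n - (x i + n * √(κ / 2 * x i))
      ≤ expect (interactionLaw π (ν' i) n) fun h => n - stoppedShownCount S B n i n h := by
    intro i hi
    rw [expect_sub, expect_const]
    refine sub_le_sub_left ?_ _
    refine expect_stoppedCount_le π (fun t h x hh => ?_) (hpos i) (hlik i hi)
      (hone i) (hκ i hi) n
    have := BlockActive.init hh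
    rwa [Fin.init_snoc] at this
  -- the average of the square roots, by the Cauchy-Schwarz inequality
  have hsq : ∑ i ∈ B, √(κ / 2 * x i) ≤ 197 / 500 * B.card := by
    refine abs_le_of_sq_le_sq' ?_ (by positivity) |>.2
    calc (∑ i ∈ B, √(κ / 2 * x i)) ^ 2
        ≤ B.card * ∑ i ∈ B, √(κ / 2 * x i) ^ 2 := sq_sum_le_card_mul_sum_sq
      _ = B.card * (κ / 2 * ∑ i ∈ B, x i) := by
        rw [Finset.mul_sum B x (κ / 2)]
        congr 1
        exact Finset.sum_congr rfl fun i _ =>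
          Real.sq_sqrt (mul_nonneg (by positivity) (hx0 i))
      _ ≤ B.card * (κ / 2 * (2 * n)) := by gcongr
      _ = B.card * (κ * n) := by ring
      _ ≤ B.card * (31 / 200 * B.card) := by gcongr
      _ ≤ (197 / 500 * B.card) ^ 2 := by nlinarith [sq_nonneg (B.card : ℝ)]
  refine le_trans ?_ (Finset.sum_le_sum hi)
  rw [Finset.sum_sub_distrib, Finset.sum_add_distrib, ← Finset.mul_sum, Finset.sum_const,
    nsmul_eq_mul]
  have h8 : (8 : ℝ) ≤ B.card := by exact_mod_cast hB
  have hn : (0 : ℝ) ≤ n := n.cast_nonneg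
  -- `3 / 4 - 197 / 500 = 178 / 500`, where `1 / 4 ≥ 2 / |B|` comes from the sum of the `x i`
  have hs2 : √2 ≤ 178 / 125 := by
    rw [Real.sqrt_le_left (by norm_num)]
    norm_num
  have h1 : √2 / 4 * (n * B.card) ≤ 178 / 500 * (n * B.card) := by
    have : (0 : ℝ) ≤ n * B.card := by positivity
    nlinarith
  have h2 := mul_le_mul_of_nonneg_left hsq hn
  nlinarith [mul_le_mul_of_nonneg_left h8 hn]

/-! ### Averaging over the choice of one item in each block -/

/-- If for all `j` the average of `F j` over the coordinate `j` is at least `c / |I|`, then the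
average of `∑ j, F j` over all coordinates is at least `|J| * c / |I|`, and some point attains
it. -/
lemma exists_card_mul_le_sum {J I : Type} [Fintype J] [DecidableEq J] [Fintype I] [Nonempty I]
    (F : J → (J → I) → ℝ) {c : ℝ} (hF : ∀ j m, c ≤ ∑ i, F j (Function.update m j i)) :
    ∃ m, Fintype.card J * c ≤ Fintype.card I * ∑ j, F j m := by
  -- exchanging `m j` with `i` is an involution of the pairs `(m, i)`
  have hinv : ∀ j : J, Function.Involutive
      fun p : (J → I) × I => (Function.update p.1 j p.2, p.1 j) := by
    intro j p
    simp
  have hswap : ∀ j, ∑ m, ∑ i, F j (Function.update m j i) = Fintype.card I * ∑ m, F j m := by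
    intro j
    rw [← Fintype.sum_prod_type']
    refine (Equiv.sum_comp (hinv j).toPerm (fun p : (J → I) × I => F j p.1)).trans ?_
    rw [Fintype.sum_prod_type, Finset.mul_sum]
    simp
  obtain ⟨m, -, hm⟩ := Finset.exists_le_of_sum_le (s := Finset.univ)
    (f := fun _ : J → I => Fintype.card J * c) (g := fun m => Fintype.card I * ∑ j, F j m)
    Finset.univ_nonempty (by
      rw [← Finset.mul_sum Finset.univ _ (Fintype.card I : ℝ), Finset.sum_comm, Finset.mul_sum]
      simp only [← hswap]
      calc ∑ _m : J → I, Fintype.card J * c = ∑ _j : J, ∑ _m : J → I, c := by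
            simp only [Finset.sum_const, Finset.card_univ, nsmul_eq_mul]
            ring
        _ ≤ _ := Finset.sum_le_sum fun j _ => Finset.sum_le_sum fun m _ => hF j m)
  exact ⟨m, hm⟩

/-! ### Environments with independent items -/

/-- The Bernoulli law of mean `x`, for `x ∈ [0, 1]`. (Other `x` are projected to `[0, 1]`.) -/
noncomputable def bern (x : ℝ) : PMF Bool :=
  PMF.ofFintype (fun b => ENNReal.ofReal
    (if b then max 0 (min x 1) else 1 - max 0 (min x 1))) (by
    have h0 : 0 ≤ max 0 (min x 1) := le_max_left _ _
    have h1 : max 0 (min x 1) ≤ 1 := max_le zero_le_one (min_le_right _ _)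
    rw [Fintype.sum_bool, ← ENNReal.ofReal_add]
    · simp
    · simp
    · simp)

lemma toReal_bern {x : ℝ} (hx : x ∈ Set.Icc (0 : ℝ) 1) (b : Bool) :
    (bern x b).toReal = if b then x else 1 - x := by
  have : max 0 (min x 1) = x := by rw [min_eq_left hx.2, max_eq_right hx.1]
  rw [bern, PMF.ofFintype_apply, this, ENNReal.toReal_ofReal]
  split_ifs
  · exact hx.1
  · exact sub_nonneg.2 hx.2

lemma expect_bern {x : ℝ} (hx : x ∈ Set.Icc (0 : ℝ) 1) (f : Bool → ℝ) :
    expect (bern x) f = x * f true + (1 - x) * f false := by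
  rw [expect, Fintype.sum_bool, toReal_bern hx, toReal_bern hx]
  rfl

section ItemEnv

variable {A I β : Type} [DecidableEq I]

open Classical in
/-- The likelihood ratio of mean `1 / 2 + ε / 2` to mean `1 / 2` for the item `i`. -/
noncomputable def itemRatio (g : Bool → β) (S : A → Finset I) (ε : ℝ) (i : I) (a : A)
    (o : I → β) : ℝ :=
  if i ∈ S a then (if o i = g true then 1 + ε else 1 - ε) else 1

lemma itemRatio_pos {g : Bool → β} {S : A → Finset I} {ε : ℝ} (h0 : 0 ≤ ε) (h1 : ε < 1)
    (i : I) (a : A) (o : I → β) :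
    0 < itemRatio g S ε i a o := by
  rw [itemRatio]
  split_ifs <;> linarith

lemma toReal_bern_map {g : Bool → β} (hg : Function.Injective g) {ε : ℝ} (h0 : 0 ≤ ε)
    (h1 : ε < 1) (b : β)
    [Decidable (b = g true)] :
    ((bern (1 / 2 + ε / 2)).map g b).toReal
      = ((bern (1 / 2)).map g b).toReal * if b = g true then 1 + ε else 1 - ε := by
  classical
  have hfin : ∀ (x : ℝ) (c : Bool), (if b = g c then bern x c else 0) ≠ ⊤ := by
    intro x c
    split_ifs
    · exact PMF.apply_ne_top _ _
    · exact ENNReal.zero_ne_top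
  have hne : g true ≠ g false := fun h => Bool.noConfusion (hg h)
  have e1 : (1 / 2 + ε / 2 : ℝ) ∈ Set.Icc (0 : ℝ) 1 := ⟨by linarith, by linarith⟩
  have e2 : (1 / 2 : ℝ) ∈ Set.Icc (0 : ℝ) 1 := by norm_num
  simp only [map_apply_eq_sum, Fintype.sum_bool]
  rw [ENNReal.toReal_add (hfin _ _) (hfin _ _), ENNReal.toReal_add (hfin _ _) (hfin _ _)]
  by_cases ht : b = g true
  · have hf : b ≠ g false := ht ▸ hne
    rw [if_pos ht, if_pos ht, if_pos ht, if_neg hf, if_neg hf, toReal_bern e1, toReal_bern e2]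
    simp
    ring
  · by_cases hf : b = g false
    · rw [if_neg ht, if_neg ht, if_neg ht, if_pos hf, if_pos hf, toReal_bern e1, toReal_bern e2]
      simp
      ring
    · simp [ht, hf]

variable [Fintype I] [Fintype β]

/-- An environment with independent items: the action `a` shows the items of `S a`, for which
Bernoulli variables of means `α i` are observed, encoded by `g`; for the other items there is an
uninformative observation of law `r`. -/
noncomputable def itemEnv (g : Bool → β) (r : PMF β) (S : A → Finset I) (α : I → ℝ) (a : A) :
    PMF (I → β) :=
  prodLaw fun i => if i ∈ S a then (bern (α i)).map g else r

variable {g : Bool → β} {r : PMF β} {S : A → Finset I} {α : I → ℝ}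

lemma itemEnv_map_eval {a : A} {i : I} (hi : i ∈ S a) :
    (itemEnv g r S α a).map (fun o => o i) = (bern (α i)).map g := by
  rw [itemEnv, prodLaw_map_eval, if_pos hi]

lemma expect_itemEnv_eval {a : A} {i : I} (hi : i ∈ S a) (hα : α i ∈ Set.Icc (0 : ℝ) 1)
    (f : β → ℝ) :
    expect (itemEnv g r S α a) (fun o => f (o i))
      = α i * f (g true) + (1 - α i) * f (g false) := by
  rw [← expect_map (itemEnv g r S α a) (fun o => o i) f, itemEnv_map_eval hi, expect_map,
    expect_bern hα]

lemma toReal_itemEnv_update (hg : Function.Injective g) {ε : ℝ} (h0 : 0 ≤ ε) (h1 : ε < 1) {i : I}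
    (hi : α i = 1 / 2) (a : A) (o : I → β) :
    (itemEnv g r S (Function.update α i (1 / 2 + ε / 2)) a o).toReal
      = (itemEnv g r S α a o).toReal * itemRatio g S ε i a o := by
  classical
  simp only [itemEnv, prodLaw_apply, ENNReal.toReal_prod]
  rw [← Finset.mul_prod_erase _ _ (Finset.mem_univ i),
    ← Finset.mul_prod_erase Finset.univ (fun k => ENNReal.toReal _) (Finset.mem_univ i),
    mul_right_comm]
  congr 1
  · rw [itemRatio]
    split_ifs with h h'
    · rw [Function.update_self, hi, toReal_bern_map hg h0 h1, if_pos h']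
    · rw [Function.update_self, hi, toReal_bern_map hg h0 h1, if_neg h']
    · rw [mul_one]
  · refine Finset.prod_congr rfl fun k hk => ?_
    rw [Function.update_of_ne (Finset.ne_of_mem_erase hk)]

lemma expect_log_itemRatio (hg : Function.Injective g) {ε : ℝ} (h0 : 0 ≤ ε) (h1 : ε < 1) {i : I}
    (hi : α i = 1 / 2) {a : A} (ha : i ∈ S a) :
    expect (itemEnv g r S α a) (fun o => Real.log (itemRatio g S ε i a o))
      = -(-Real.log (1 - ε ^ 2) / 2) := by
  classical
  have hne : g false ≠ g true := fun h => Bool.noConfusion (hg h)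
  have := expect_itemEnv_eval (g := g) (r := r) (α := α) ha (by rw [hi]; norm_num)
    (fun b => Real.log (if b = g true then 1 + ε else 1 - ε))
  simp only [itemRatio, if_pos ha]
  rw [this, hi, if_pos rfl, if_neg hne]
  have : 1 - ε ^ 2 = (1 + ε) * (1 - ε) := by ring
  rw [this, Real.log_mul (by linarith) (by linarith)]
  ring

end ItemEnv

lemma neg_log_one_sub_le {x : ℝ} (h0 : 0 ≤ x) (h1 : x ≤ 1 / 4) :
    -Real.log (1 - x) ≤ 29 / 24 * x := by
  have h := Real.abs_log_sub_add_sum_range_le (x := x) (by rw [abs_of_nonneg h0]; linarith) 2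
  rw [abs_of_nonneg h0, Finset.sum_range_succ, Finset.sum_range_one] at h
  have h2 := (abs_le.1 h).1
  have h3 : x ^ 3 / (1 - x) ≤ 1 / 12 * x := by
    rw [div_le_iff₀ (by linarith)]
    nlinarith [mul_nonneg h0 h0, mul_nonneg h0 (sub_nonneg.2 h1)]
  norm_num at h2 h3
  nlinarith [mul_nonneg h0 (sub_nonneg.2 h1)]

/-! ### The lower bound for environments with independent items -/

/-- The expected return is the sum of the expected rewards of the actions played. -/
lemma expectedReturn_eq {A O : Type} [Fintype A] [Fintype O] (π : Policy A O) (env : A → PMF O)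
    {R : A → O → ℝ} {f : A → ℝ} (hR : ∀ a, expect (env a) (R a) = f a) (n : ℕ) :
    expectedReturn π env R n = expect (interactionLaw π env n) fun h => ∑ t, f (h t).1 := by
  rw [expectedReturn_eq_expect]
  have h1 : ∀ (t : ℕ), expect (interactionLaw π env t) (accum (fun _ _ (x : A × O) => R x.1 x.2) t)
      = expect (interactionLaw π env t) (accum (fun _ _ (x : A × O) => f x.1) t) := by
    intro t
    induction t with
    | zero => rfl
    | succ t ih =>
      rw [expect_accum_succ, expect_accum_succ, ih]
      simp only [expect_const, hR]
  have h2 := h1 n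
  rwa [funext (accum_eq_sum _ n), funext (accum_eq_sum _ n)] at h2

section LowerBound

variable {A I β : Type} {K N n : ℕ}

/-- The means of the items, which are arranged in `K` blocks of `N` items by `e`: item `m j` of the
block `j` has mean `1 / 2 + ε / 2`, the others have mean `1 / 2`. -/
noncomputable def blockMeans (e : Fin K × Fin N ≃ I) (ε : ℝ) (m : Fin K → Fin N) (l : I) : ℝ :=
  if (e.symm l).2 = m (e.symm l).1 then 1 / 2 + ε / 2 else 1 / 2

/-- The means of `blockMeans` with the special item of block `j` made ordinary. -/
noncomputable def nullMeans (e : Fin K × Fin N ≃ I) (ε : ℝ) (m : Fin K → Fin N) (j : Fin K)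
    (l : I) : ℝ :=
  if (e.symm l).1 = j then 1 / 2 else blockMeans e ε m l

/-- The items of the block `j`. -/
def block (e : Fin K × Fin N ≃ I) (j : Fin K) : Finset I :=
  Finset.univ.map ⟨fun i : Fin N => e (j, i), fun i i' h => by simpa using h⟩

variable (e : Fin K × Fin N ≃ I) {ε : ℝ}

lemma sum_block (j : Fin K) (f : I → ℝ) : ∑ l ∈ block e j, f l = ∑ i, f (e (j, i)) := by
  rw [block, Finset.sum_map]
  rfl

lemma blockMeans_update [DecidableEq I] (m : Fin K → Fin N) (j : Fin K) (i : Fin N) :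
    blockMeans e ε (Function.update m j i)
      = Function.update (nullMeans e ε m j) (e (j, i)) (1 / 2 + ε / 2) := by
  funext l
  obtain ⟨⟨j', i'⟩, rfl⟩ := e.surjective l
  by_cases hj : j' = j
  · subst hj
    by_cases hi : i' = i
    · subst hi
      simp [blockMeans]
    · simp [blockMeans, nullMeans, hi]
  · simp [blockMeans, nullMeans, hj]

lemma blockMeans_mem (h0 : 0 ≤ ε) (h1 : ε ≤ 1) (m : Fin K → Fin N) (l : I) :
    blockMeans e ε m l ∈ Set.Icc (0 : ℝ) 1 := by
  rw [blockMeans]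
  split_ifs <;> constructor <;> linarith

variable [Fintype I]

lemma sum_blockMeans_mul (m : Fin K → Fin N) (f : I → ℝ) :
    ∑ l, blockMeans e ε m l * f l = 1 / 2 * ∑ l, f l + ε / 2 * ∑ j, f (e (j, m j)) := by
  have h : ∀ l, blockMeans e ε m l * f l
      = 1 / 2 * f l + if (e.symm l).2 = m (e.symm l).1 then ε / 2 * f l else 0 := by
    intro l
    rw [blockMeans]
    split_ifs <;> ring
  simp only [h, Finset.sum_add_distrib, ← Finset.mul_sum]
  rw [← e.sum_comp (fun l => if _ = _ then _ else _), Fintype.sum_prod_type, Finset.mul_sum]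
  simp [Finset.mul_sum]

variable [DecidableEq I]

/-- The number of missed showings of special items, bounded below by stopped counts. As `n * K`
items are shown altogether, it equals the number of showings of ordinary items, whence the factor
`2`. -/
lemma sum_sub_stoppedShownCount_le {O : Type} {S : A → Finset I} (hS : ∀ a, (S a).card = K)
    (m : Fin K → Fin N) (h : Fin n → A × O) :
    ∑ j, (n - stoppedShownCount S (block e j) n (e (j, m j)) n h)
      ≤ 2 * (n * K - ∑ j, shownCount S (e (j, m j)) h) := by
  have hmem : ∀ j, e (j, m j) ∈ block e j := fun j =>
    Finset.mem_map.2 ⟨m j, Finset.mem_univ _, rfl⟩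
  have htot : ∑ j, ∑ l ∈ block e j, shownCount S l h = n * K := by
    simp only [sum_block]
    rw [← Fintype.sum_prod_type' (f := fun j i => shownCount S (e (j, i)) h)]
    simp only [Prod.mk.eta]
    rw [e.sum_comp (fun l => shownCount S l h)]
    have := sum_mul_shownCount (S := S) (fun _ => 1) h
    simpa [hS] using this
  refine (Finset.sum_le_sum fun j _ => sub_stoppedShownCount_le (hmem j) h).trans_eq ?_
  rw [Finset.sum_add_distrib, Finset.sum_sub_distrib, Finset.sum_sub_distrib, htot]
  simp
  ring

/-- For every policy there are means of the items for which the regret with respect to some set of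
`K` items is at least of order `√(K * L * n)`. -/
lemma exists_means_regret_ge [Fintype A] [Fintype β] {g : Bool → β}
    (hg : Function.Injective g) (r : PMF β)
    {S : A → Finset I} (hS : ∀ a, (S a).card = K) (R : A → (I → β) → ℝ)
    (hR : ∀ α : I → ℝ, (∀ i, α i ∈ Set.Icc (0 : ℝ) 1) → ∀ a,
      expect (itemEnv g r S α a) (R a) = ∑ i ∈ S a, α i)
    (e : Fin K × Fin N ≃ I) (hN : 8 ≤ N) (hnK : K ≤ n) (hnN : N ≤ n) (π : Policy A (I → β)) :
    ∃ α : I → ℝ, (∀ i, α i ∈ Set.Icc (0 : ℝ) 1) ∧ ∃ T : Finset I, T.card = K ∧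
      √((K : ℝ) * (N * K) * n) / (16 * √2)
        ≤ n * ∑ i ∈ T, α i - expectedReturn π (itemEnv g r S α) R n := by
  have hN0 : (0 : ℝ) < N := by exact_mod_cast (by omega : 0 < N)
  have hn0 : (0 : ℝ) < n := by exact_mod_cast (by omega : 0 < n)
  have hNn : (N : ℝ) ≤ n := by exact_mod_cast hnN
  have : Nonempty (Fin N) := ⟨⟨0, by omega⟩⟩
  -- the gap `ε / 2` between special and ordinary items balances regret and information
  set ε : ℝ := √(N / n) / 2 with hε
  have hs0 : 0 < √((N : ℝ) / n) := Real.sqrt_pos.2 (by positivity)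
  have hs1 : √((N : ℝ) / n) ≤ 1 := by
    rw [Real.sqrt_le_left one_pos.le, one_pow, div_le_one hn0]
    exact hNn
  have hε0 : 0 ≤ ε := by positivity
  have hε1 : ε < 1 := by rw [hε]; linarith
  have hεsq : ε ^ 2 * n = N / 4 := by
    rw [hε, div_pow, Real.sq_sqrt (by positivity)]
    field_simp
    norm_num
  have hεsq' : ε ^ 2 ≤ 1 / 4 := by rw [hε]; nlinarith
  set κ : ℝ := -Real.log (1 - ε ^ 2) / 2 with hκ
  have hκ0 : 0 ≤ κ := by
    have := Real.log_nonpos (x := 1 - ε ^ 2) (by linarith) (by nlinarith)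
    rw [hκ]
    linarith
  have hκn : κ * n ≤ 31 / 200 * N := by
    have h1 := neg_log_one_sub_le (sq_nonneg ε) hεsq'
    have h2 : κ * n ≤ (29 / 24 * ε ^ 2 / 2) * n := by
      rw [hκ]
      gcongr
    nlinarith
  have hcard : ∀ j, (block e j).card = N := fun j => by simp [block]
  let env := fun m => itemEnv g r S (blockMeans e ε m)
  obtain ⟨m, hm⟩ := exists_card_mul_le_sum
    (fun j m => expect (interactionLaw π (env m) n)
      fun h => n - stoppedShownCount S (block e j) n (e (j, m j)) n h)
    (c := √2 / 4 * (n * N)) (by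
      intro j m
      have hnull : ∀ i, nullMeans e ε m j (e (j, i)) = 1 / 2 := fun i => by simp [nullMeans]
      have h := le_sum_sub_stoppedShownCount π (S := S) (B := block e j) (n := n) (κ := κ)
        (ρ := itemRatio g S ε) (ν := itemEnv g r S (nullMeans e ε m j))
        (ν' := fun l => itemEnv g r S (Function.update (nullMeans e ε m j) l (1 / 2 + ε / 2)))
        (fun a => (hS a).trans_le hnK) (by rw [hcard]; exact hN)
        (itemRatio_pos hε0 hε1)
        (by
          intro l hl a o
          obtain ⟨i, -, rfl⟩ := Finset.mem_map.1 hl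
          exact toReal_itemEnv_update hg hε0 hε1 (hnull i) a o)
        (fun i a o ha => if_neg ha)
        (by
          intro l hl a ha
          obtain ⟨i, -, rfl⟩ := Finset.mem_map.1 hl
          exact expect_log_itemRatio hg hε0 hε1 (hnull i) ha)
        hκ0 (by rw [hcard]; exact hκn)
      rw [hcard, sum_block] at h
      simpa only [env, blockMeans_update, Function.update_self] using h)
  refine ⟨blockMeans e ε m, blockMeans_mem e hε0 hε1.le m,
    Finset.univ.map ⟨fun j => e (j, m j), fun j j' h => (Prod.ext_iff.1 (e.injective h)).1⟩,
    by simp, ?_⟩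
  have hopt : ∑ l ∈ Finset.univ.map
        ⟨fun j => e (j, m j), fun j j' h => (Prod.ext_iff.1 (e.injective h)).1⟩,
      blockMeans e ε m l = K * (1 / 2 + ε / 2) := by
    have h : ∀ j, blockMeans e ε m (e (j, m j)) = 1 / 2 + ε / 2 := fun j => by simp [blockMeans]
    rw [Finset.sum_map]
    exact (Finset.sum_congr rfl fun j _ => h j).trans (by simp [mul_add])
  have hret : expectedReturn π (env m) R n
      = expect (interactionLaw π (env m) n) fun h =>
          1 / 2 * (n * K) + ε / 2 * ∑ j, shownCount S (e (j, m j)) h := by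
    rw [expectedReturn_eq π _ (hR _ (blockMeans_mem e hε0 hε1.le m))]
    refine congrArg _ (funext fun h => ?_)
    rw [← sum_mul_shownCount, sum_blockMeans_mul]
    have := sum_mul_shownCount (S := S) (fun _ => 1) h
    simp only [one_mul, Finset.sum_const, hS, Finset.card_univ, Fintype.card_fin,
      nsmul_eq_mul, mul_one] at this
    rw [this]
  have hE := expect_mono (interactionLaw π (env m) n)
    fun h => sum_sub_stoppedShownCount_le e hS m h
  rw [expect_sum, expect_const_mul, expect_sub, expect_const] at hE
  rw [hopt]
  change _ ≤ _ - expectedReturn π (env m) R n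
  rw [hret, expect_add, expect_const, expect_const_mul]
  simp only [Fintype.card_fin] at hm
  have hsqrt : √((K : ℝ) * (N * K) * n) = K * (√(N / n) * n) := by
    have : (K : ℝ) * (N * K) * n = K ^ 2 * (N / n * n ^ 2) := by field_simp
    rw [this, Real.sqrt_mul (by positivity), Real.sqrt_mul (by positivity),
      Real.sqrt_sq (by positivity), Real.sqrt_sq (by positivity)]
  have htarget : √((K : ℝ) * (N * K) * n) / (16 * √2) = ε / 4 * (K * (√2 / 4 * n)) := by
    have h2 : √2 * √2 = 2 := Real.mul_self_sqrt (by norm_num)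
    rw [hsqrt, hε, div_eq_iff (by positivity)]
    linear_combination (-(K : ℝ) * (√(N / n) * n) / 2) * h2
  rw [htarget]
  have hm' : (K : ℝ) * (√2 / 4 * n) ≤ ∑ j, expect (interactionLaw π (env m) n)
      fun h => n - stoppedShownCount S (block e j) n (e (j, m j)) n h := by
    refine le_of_mul_le_mul_left ?_ hN0
    linarith
  nlinarith [mul_le_mul_of_nonneg_left (hm'.trans hE) (by positivity : 0 ≤ ε / 4)]

end LowerBound

/-! ### Document-based ranking problems -/

section Ranking

variable {L K : ℕ}

/-- The items on the visible positions of a ranking. -/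
def visibleItems (K : ℕ) (a : Ranking L) : Finset (Fin L) :=
  Finset.univ.filter fun i => (a.symm i : ℕ) < K

lemma apply_mem_visibleItems {a : Ranking L} {k : Fin L} :
    a k ∈ visibleItems K a ↔ (k : ℕ) < K := by
  simp [visibleItems]

lemma topSum_comp (f : Fin L → ℝ) (a : Ranking L) :
    topSum K (fun k => f (a k)) = ∑ i ∈ visibleItems K a, f i := by
  rw [visibleItems, Finset.sum_filter, ← Equiv.sum_comp a, topSum]
  simp

lemma card_visibleItems (hK : K ≤ L) (a : Ranking L) : (visibleItems K a).card = K := by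
  have h : (visibleItems K a) = (Finset.univ.filter fun k : Fin L => (k : ℕ) < K).map
      a.toEmbedding := by
    ext i
    simp [visibleItems, Finset.mem_map_equiv]
  rw [h, Finset.card_map, Fin.card_filter_val_lt, min_eq_right hK]

lemma exists_visibleItems_eq (T : Finset (Fin L)) : ∃ a : Ranking L, visibleItems T.card a = T := by
  classical
  have hT : T.card ≤ L := by simpa using T.card_le_univ
  have hcard : Fintype.card {k : Fin L // (k : ℕ) < T.card}
      = Fintype.card {i : Fin L // i ∈ T} := by
    rw [Fintype.card_subtype, Fin.card_filter_val_lt, min_eq_right hT, Fintype.card_coe]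
  let a : Ranking L := (Fintype.equivOfCardEq hcard).extendSubtype
  refine ⟨a, (Finset.eq_of_subset_of_card_le (fun i hi => ?_) ?_)⟩
  · obtain ⟨k, rfl⟩ := a.surjective i
    exact Equiv.extendSubtype_mem _ _ (apply_mem_visibleItems.1 hi)
  · rw [card_visibleItems hT]

/-- An optimal ranking shows `K` items of maximal total attractiveness. -/
lemma IsOptimal.topSum_le (hK : K ≤ L) {α : Fin L → ℝ} {aOpt : Ranking L}
    (hopt : IsOptimal K α aOpt) (a : Ranking L) :
    topSum K (fun k => α (a k)) ≤ topSum K (fun k => α (aOpt k)) := by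
  rcases K.eq_zero_or_pos with rfl | h0
  · simp [topSum]
  have hK1 : K - 1 < L := by omega
  -- `c` separates the attractiveness of the visible items of `aOpt` from that of the others
  obtain ⟨c, hc, hc'⟩ : ∃ c, (∀ k : Fin L, (k : ℕ) < K → c ≤ α (aOpt k)) ∧
      ∀ k : Fin L, K ≤ (k : ℕ) → α (aOpt k) ≤ c :=
    ⟨α (aOpt ⟨K - 1, hK1⟩),
      fun k hk => hopt k hk _ (Fin.mk_le_mk.2 (show (k : ℕ) ≤ K - 1 by omega)),
      fun k hk => hopt _ (show K - 1 < K by omega) k (Fin.mk_le_mk.2 (show K - 1 ≤ k by omega))⟩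
  have h : ∑ i ∈ visibleItems K a, (α i - c) ≤ ∑ i ∈ visibleItems K aOpt, (α i - c) := by
    rw [← Finset.univ_inter (visibleItems K a), ← Finset.univ_inter (visibleItems K aOpt),
      ← Finset.sum_ite_mem, ← Finset.sum_ite_mem]
    refine Finset.sum_le_sum fun i _ => ?_
    obtain ⟨k, rfl⟩ := aOpt.surjective i
    by_cases hk : (k : ℕ) < K
    · rw [if_pos (apply_mem_visibleItems.2 hk)]
      split_ifs
      · exact le_rfl
      · exact sub_nonneg.2 (hc k hk)
    · rw [if_neg (fun h => hk (apply_mem_visibleItems.1 h))]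
      split_ifs
      · exact sub_nonpos.2 (hc' k (not_lt.1 hk))
      · exact le_rfl
  rw [topSum_comp, topSum_comp]
  simp only [Finset.sum_sub_distrib, Finset.sum_const, card_visibleItems hK] at h
  linarith

/-- Visible items are clicked independently, with probability their attractiveness. -/
noncomputable def documentLaw (K : ℕ) (α : Fin L → ℝ) : Ranking L → PMF (Clicks L) :=
  itemEnv id (PMF.pure false) (visibleItems K) α

lemma coordMean_documentLaw {α : Fin L → ℝ} (hα : ∀ i, α i ∈ Set.Icc (0 : ℝ) 1) (a : Ranking L)
    (i : Fin L) :
    coordMean (documentLaw K α a) i = if i ∈ visibleItems K a then α i else 0 := by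
  rw [coordMean, documentLaw, itemEnv, prodLaw_map_eval]
  split_ifs
  · rw [PMF.map_id, toReal_bern (hα i), if_pos rfl]
  · simp

lemma clickProb_documentLaw {α : Fin L → ℝ} (hα : ∀ i, α i ∈ Set.Icc (0 : ℝ) 1) (a : Ranking L)
    (k : Fin L) :
    clickProb (documentLaw K α) a k = if (k : ℕ) < K then α (a k) else 0 := by
  simp only [clickProb, coordMean_documentLaw hα, apply_mem_visibleItems]

lemma topSum_clickProb_documentLaw {α : Fin L → ℝ} (hα : ∀ i, α i ∈ Set.Icc (0 : ℝ) 1)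
    (a : Ranking L) :
    topSum K (clickProb (documentLaw K α) a) = topSum K fun k => α (a k) := by
  refine Finset.sum_congr rfl fun k _ => ?_
  rw [clickProb_documentLaw hα]
  split_ifs <;> rfl

/-- The document-based ranking problem with attractiveness `α` and independent clicks. -/
noncomputable def documentProblem (hK : K ≤ L) (α : Fin L → ℝ)
    (hα : ∀ i, α i ∈ Set.Icc (0 : ℝ) 1) : RankingProblem L K where
  clickLaw := documentLaw K α
  α := α
  α_mem := hα
  click_zero a k hk := by rw [clickProb_documentLaw hα, if_neg (not_lt.2 hk)]
  optimal_max aOpt hopt a := by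
    rw [topSum_clickProb_documentLaw hα, topSum_clickProb_documentLaw hα]
    exact hopt.topSum_le hK a
  exchange i j _ a := by
    rw [clickProb_documentLaw hα, clickProb_documentLaw hα, Equiv.Perm.mul_apply,
      Equiv.apply_symm_apply, Equiv.swap_apply_left]
    split_ifs
    · rw [mul_comm]
    · simp
  lowest_exam a aOpt _ k hk := by
    rw [clickProb_documentLaw hα, clickProb_documentLaw hα, hk]

end Ranking

lemma independentCoordinates_prodLaw {L : ℕ} (p : Fin L → PMF Bool) :
    IndependentCoordinates (prodLaw p) := by
  intro c
  rw [prodLaw_apply]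
  exact Finset.prod_congr rfl fun i _ => by rw [prodLaw_map_eval]

/-- The clicks of a round sum up to the attractiveness of the visible items. -/
lemma expect_sum_clicks {L K : ℕ} {α : Fin L → ℝ} (hα : ∀ i, α i ∈ Set.Icc (0 : ℝ) 1)
    (a : Ranking L) :
    expect (documentLaw K α a) (fun c => ∑ i, if c i = true then (1 : ℝ) else 0)
      = ∑ i ∈ visibleItems K a, α i := by
  rw [expect_sum, ← Finset.univ_inter (visibleItems K a), ← Finset.sum_ite_mem]
  refine Finset.sum_congr rfl fun i _ => ?_
  rw [← expect_map (documentLaw K α a) (fun c => c i) (fun b => if b = true then (1 : ℝ) else 0),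
    ← coordMean_documentLaw hα, expect, Fintype.sum_bool, coordMean]
  simp

/-! ### Semi-bandits -/

/-- The feedback of a semi-bandit with independent rewards is that of an environment with
independent items. -/
lemma semiBanditEnv_prodLaw {L K : ℕ} (α : Fin L → ℝ) :
    semiBanditEnv (m := K) (prodLaw fun i => bern (α i))
      = itemEnv some (PMF.pure none) (fun S : MSet L K => S.1) α := by
  funext S
  have h := prodLaw_map (fun i => bern (α i)) fun i b => if i ∈ S.1 then some b else none
  rw [semiBanditEnv, h, itemEnv]
  congr
  funext i
  split_ifs
  · rfl
  · exact PMF.map_const _ _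

lemma coordMean_prodLaw_bern {L : ℕ} {α : Fin L → ℝ} (hα : ∀ i, α i ∈ Set.Icc (0 : ℝ) 1)
    (i : Fin L) : coordMean (prodLaw fun i => bern (α i)) i = α i := by
  rw [coordMean, prodLaw_map_eval, toReal_bern (hα i), if_pos rfl]

end OnlineRanking

open OnlineRanking in
theorem theorem2 (L K N n : ℕ) (hL : L = N * K) (hN : 8 ≤ N) (hnK : K ≤ n) (hnN : N ≤ n) :
    (∀ π : OnlineRanking.Policy (OnlineRanking.Ranking L) (OnlineRanking.Clicks L),
      ∃ P : OnlineRanking.RankingProblem L K,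
        P.IsDocumentBased ∧
        (∀ a, OnlineRanking.IndependentCoordinates (P.clickLaw a)) ∧
        √((K : ℝ) * L * n) / (16 * √2) ≤ P.regret π n) ∧
    (∀ π : OnlineRanking.Policy (OnlineRanking.MSet L K) (OnlineRanking.SemiFeedback L),
      ∃ D : PMF (Fin L → Bool),
        OnlineRanking.IndependentCoordinates D ∧
        √((K : ℝ) * L * n) / (16 * √2) ≤ OnlineRanking.semiBanditRegret D π n) := by
  have hKL : K ≤ L := hL ▸ Nat.le_mul_of_pos_left K (by omega)
  have hLcast : (L : ℝ) = N * K := by rw [hL, Nat.cast_mul]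
  let e : Fin K × Fin N ≃ Fin L :=
    (Equiv.prodComm _ _).trans (finProdFinEquiv.trans (finCongr hL.symm))
  rw [hLcast]
  constructor
  · intro π
    obtain ⟨α, hα, T, hT, h⟩ := exists_means_regret_ge Function.injective_id (PMF.pure false)
      (card_visibleItems hKL) (fun _ c => ∑ i, if c i = true then (1 : ℝ) else 0)
      (fun α hα a => expect_sum_clicks hα a) e hN hnK hnN π
    refine ⟨documentProblem hKL α hα, fun a k => clickProb_documentLaw hα a k,
      fun a => independentCoordinates_prodLaw _, h.trans (sub_le_sub_right ?_ _)⟩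
    refine mul_le_mul_of_nonneg_left ?_ n.cast_nonneg
    obtain ⟨a, ha⟩ := exists_visibleItems_eq T
    rw [hT] at ha
    refine le_trans (le_of_eq ?_) (le_ciSup (Set.finite_range _).bddAbove a)
    exact ((topSum_clickProb_documentLaw hα a).trans (by rw [topSum_comp, ha])).symm
  · intro π
    obtain ⟨α, hα, T, hT, h⟩ := exists_means_regret_ge (Option.some_injective Bool)
      (PMF.pure none) (S := fun S : MSet L K => S.1) (fun S => S.2)
      (fun S o => ∑ i ∈ S.1, if o i = some true then (1 : ℝ) else 0)
      (fun α hα S => by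
        rw [expect_sum]
        refine Finset.sum_congr rfl fun i hi => ?_
        rw [expect_itemEnv_eval (S := fun S : MSet L K => S.1) hi (hα i)
          (fun b => if b = some true then (1 : ℝ) else 0)]
        simp) e hN hnK hnN π
    refine ⟨prodLaw fun i => bern (α i), independentCoordinates_prodLaw _, ?_⟩
    rw [semiBanditRegret, semiBanditEnv_prodLaw]
    refine h.trans (sub_le_sub_right ?_ _)
    refine mul_le_mul_of_nonneg_left ?_ n.cast_nonneg
    refine le_trans (le_of_eq ?_) (le_ciSup (Set.finite_range _).bddAbove ⟨T, hT⟩)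
    simp only [coordMean_prodLaw_bern hα]
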